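/- Let $\alpha,\beta\in[0,1]$. For $n\ge 1$ let $\Sigma_n=\{1,\dots,n-1\}$ and $\Omega_n=\{0,1\}^{\Sigma_n}$. Let $\{\eta_t : t\ge 0\}$ be the symmetric simple exclusion process with slow boundaries, that is, the càdlàg Markov process on $\Omega_n$ with generator $\mathcal L_n$ given, for $f:\Omega_n\to\mathbb R$, by $$(\mathcal L_n f)(\eta)=\sum_{x=1}^{n-2}\big(f(\eta^{x,x+1})-f(\eta)\big)+\frac1n\sum_{x\in\{1,n-1\}}\big[r_x(1-\eta(x))+(1-r_x)\eta(x)\big]\big(f(\sigma^x\eta)-f(\eta)\big),$$ where $r_1=\alpha$, $r_{n-1}=\beta$, $\eta^{x,x+1}$ is obtained from $\eta$ by exchanging the values at $x$ and $x+1$, and $\sigma^x\eta$ by replacing $\eta(x)$ with $1-\eta(x)$. For each $n$ let the process start from a probability measure $\mu_n$ on $\Omega_n$, write $\mathbb E_{\mu_n}$ for the expectation, and for $t\ge 0$ set $$\rho^n_t(x)=\mathbb E_{\mu_n}[\eta_{tn^2}(x)],\qquad \varphi^n_t(x,y)=\mathbb E_{\mu_n}[\eta_{tn^2}(x)\,\eta_{tn^2}(y)]-\rho^n_t(x)\rho^n_t(y).$$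 Suppose that there are a Lipschitz function $\rho_0:[0,1]\to[0,1]$ and constants $C_1,C_2$ such that, for every $n$, $$\max_{x\in\Sigma_n}\big|\rho^n_0(x)-\rho_0(\tfrac xn)\big|\le\frac{C_1}{n},\qquad \max_{1\le x<y\le n-1}\big|\varphi^n_0(x,y)\big|\le\frac{C_2}{n}.$$ Then there is a constant $C>0$, not depending on $n$, such that for every $n\ge1$ $$\sup_{t\ge 0}\ \max_{0<x<y<n}\ |\varphi^n_t(x,y)|\le\frac Cn .$$ (For $n\le 2$ there are no such pairs and the claim is empty.) -/

import Mathlib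

open MeasureTheory Filter Topology
open scoped NNReal

namespace SlowSSEP

/-- The bulk `Σ_n = {1, …, n - 1}`. -/
abbrev Site (n : ℕ) : Type := {x : ℕ // x ∈ Finset.Ioo 0 n}

/-- The configuration space `{0, 1} ^ Σ_n`; `η x = true` means that `x` is occupied. -/
abbrev Config (n : ℕ) : Type := Site n → Bool

/-- The occupation variable `η(x) ∈ {0, 1}` as a real number. -/
def occ {n : ℕ} (x : Site n) (η : Config n) : ℝ := if η x then 1 else 0

/-- The configuration `η^{x,y}`: the occupation variables at `x` and `y` are exchanged. -/
def exchange {n : ℕ} (x y : Site n) (η : Config n) : Config n :=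
  fun z => if z = x then η y else if z = y then η x else η z

/-- The configuration `σ^x η`: the occupation variable at `x` is flipped. -/
def flipAt {n : ℕ} (x : Site n) (η : Config n) : Config n :=
  fun z => if z = x then !(η z) else η z

/-- The exclusion part of the generator, a sum over the bonds `{x, x + 1}`, `1 ≤ x ≤ n - 2`. -/
def bulkGen (n : ℕ) (f : Config n → ℝ) (η : Config n) : ℝ :=
  ∑ x : Site n, ∑ y : Site n,
    if y.1 = x.1 + 1 then f (exchange x y η) - f η else 0

/-- The flip rate (before slowing down) at a site in contact with a reservoir of density `r`. -/
def flipRate {n : ℕ} (r : ℝ) (x : Site n) (η : Config n) : ℝ :=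
  r * (1 - occ x η) + (1 - r) * occ x η

/-- The boundary part of the generator: the site `1` is in contact with a reservoir of density `α`
and the site `n - 1` with a reservoir of density `β`; all the rates are divided by `n`. -/
noncomputable def boundaryGen (α β : ℝ) (n : ℕ) (f : Config n → ℝ) (η : Config n) : ℝ :=
  (1 / (n : ℝ)) * ∑ x : Site n,
    ((if x.1 = 1 then flipRate α x η * (f (flipAt x η) - f η) else 0) +
      (if x.1 + 1 = n then flipRate β x η * (f (flipAt x η) - f η) else 0))

/-- The generator `L_n` of the symmetric simple exclusion process with slow boundaries. -/
noncomputable def generator (α β : ℝ) (n : ℕ) : (Config n → ℝ) →ₗ[ℝ] (Config n → ℝ) where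
  toFun f η := bulkGen n f η + boundaryGen α β n f η
  map_add' f g := by
    funext η
    have h1 : bulkGen n (f + g) η = bulkGen n f η + bulkGen n g η := by
      simp only [bulkGen, ← Finset.sum_add_distrib]
      refine Finset.sum_congr rfl fun x _ => Finset.sum_congr rfl fun y _ => ?_
      split_ifs <;> (try simp only [Pi.add_apply]) <;> ring
    have h2 : boundaryGen α β n (f + g) η = boundaryGen α β n f η + boundaryGen α β n g η := by
      simp only [boundaryGen, ← mul_add, ← Finset.sum_add_distrib]
      congr 1
      refine Finset.sum_congr rfl fun x _ => ?_
      split_ifs <;> (try simp only [Pi.add_apply]) <;> ring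
    simp only [Pi.add_apply, h1, h2]
    ring
  map_smul' c f := by
    funext η
    have h1 : bulkGen n (c • f) η = c * bulkGen n f η := by
      simp only [bulkGen, Finset.mul_sum]
      refine Finset.sum_congr rfl fun x _ => Finset.sum_congr rfl fun y _ => ?_
      split_ifs <;> (try simp only [Pi.smul_apply, smul_eq_mul]) <;> ring
    have h2 : boundaryGen α β n (c • f) η = c * boundaryGen α β n f η := by
      simp only [boundaryGen, Finset.mul_sum]
      refine Finset.sum_congr rfl fun x _ => ?_
      split_ifs <;> (try simp only [Pi.smul_apply, smul_eq_mul]) <;> ring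
    simp only [RingHom.id_apply, Pi.smul_apply, smul_eq_mul, h1, h2]
    ring

/-- The semigroup `e^{tL}` of a generator `L` acting on functions on a finite set. -/
noncomputable def semigroup {S : Type*} [Fintype S] (L : (S → ℝ) →ₗ[ℝ] (S → ℝ)) (t : ℝ) :
    (S → ℝ) →L[ℝ] (S → ℝ) :=
  NormedSpace.exp (t • LinearMap.toContinuousLinearMap L)

/-- The σ-algebra generated by the process up to time `s`. -/
abbrev past {S Ω : Type*} [MeasurableSpace S] (X : ℝ≥0 → Ω → S) (s : ℝ≥0) : MeasurableSpace Ω :=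
  ⨆ r : Set.Iic s, MeasurableSpace.comap (X r) inferInstance

/-- `X` is, under `P`, a continuous-time Markov process on the finite set `S`, with càdlàg paths,
generator `L` and initial law `μ`. -/
structure IsMarkovProcess {S Ω : Type*} [Fintype S] [TopologicalSpace S] [MeasurableSpace S]
    [MeasurableSpace Ω] (L : (S → ℝ) →ₗ[ℝ] (S → ℝ)) (μ : Measure S) (P : Measure Ω)
    (X : ℝ≥0 → Ω → S) : Prop where
  measurable : ∀ t, Measurable (X t)
  right_continuous : ∀ ω t, ContinuousWithinAt (fun s => X s ω) (Set.Ici t) t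
  left_limits : ∀ ω t, ∃ l, Tendsto (fun s => X s ω) (𝓝[<] t) (𝓝 l)
  initial : P.map (X 0) = μ
  markov : ∀ (s t : ℝ≥0) (f : S → ℝ),
    P[fun ω => f (X (s + t) ω) | past X s] =ᵐ[P] fun ω => semigroup L t f (X s ω)

/-- The mean occupation `E_μ[η(x)]` under a probability measure `μ` on configurations. -/
noncomputable def mean {n : ℕ} (μ : Measure (Config n)) (x : Site n) : ℝ :=
  ∫ η, occ x η ∂μ

/-- The correlation `E_μ[η(x) η(y)] - E_μ[η(x)] E_μ[η(y)]` under a probability measure `μ` on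
configurations. -/
noncomputable def corr {n : ℕ} (μ : Measure (Config n)) (x y : Site n) : ℝ :=
  ∫ η, occ x η * occ y η ∂μ - mean μ x * mean μ y

/-- The density `ρ_t^n(x) = E[η_{t n²}(x)]` in the diffusive time scale. -/
noncomputable def density {n : ℕ} {Ω : Type*} [MeasurableSpace Ω] (P : Measure Ω)
    (η : ℝ≥0 → Ω → Config n) (t : ℝ≥0) (x : Site n) : ℝ :=
  ∫ ω, occ x (η (t * (n : ℝ≥0) ^ 2) ω) ∂P

/-- The two-point correlation function
`φ_t^n(x, y) = E[η_{t n²}(x) η_{t n²}(y)] - ρ_t^n(x) ρ_t^n(y)`. -/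
noncomputable def twoPoint {n : ℕ} {Ω : Type*} [MeasurableSpace Ω] (P : Measure Ω)
    (η : ℝ≥0 → Ω → Config n) (t : ℝ≥0) (x y : Site n) : ℝ :=
  ∫ ω, occ x (η (t * (n : ℝ≥0) ^ 2) ω) * occ y (η (t * (n : ℝ≥0) ^ 2) ω) ∂P
    - density P η t x * density P η t y

end SlowSSEP

open SlowSSEP

/-! The one- and two-point functions satisfy closed linear equations. Ghost values at `0` and `n`
(`extOcc`) turn each reservoir into a Robin condition, so that the density solves the discrete heat
equation on the sites, and the correlations solve the two-dimensional one on the triangle `0 < x < y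
< n`, with source minus the squared density gradient on the pairs `(x, x + 1)`.

The gradient itself solves a heat equation whose boundary values, of the form (density minus
reservoir density)/n up to sign, are at most `1 / n` in absolute value. With the Lipschitz profile
at time zero, the maximum principle keeps the gradient of order `1 / n` (`abs_gradient_le`), so the
source is of order `1 / n ^ 2`. An explicit stationary solution with unit source, `barrier`, is of
order `n`; comparison with it (`correlation_le_barrier`) bounds the correlations by a multiple of `1
/ n`. All bounds are uniform in time, so the diffusive rescaling plays no role in them. -/

namespace SlowSSEP

/-! ### Maximum principles -/

/-- Maximum principle for a finite system of differential inequalities. -/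
theorem nonpos_of_deriv_nonpos_at_max {ι : Type*} (s : Finset ι) (w w' : ℝ → ι → ℝ)
    (hd : ∀ t, 0 ≤ t → ∀ i ∈ s, HasDerivAt (fun r => w r i) (w' t i) t)
    (h0 : ∀ i ∈ s, w 0 i ≤ 0)
    (hmax : ∀ t, 0 ≤ t → ∀ i ∈ s, 0 < w t i → (∀ j ∈ s, w t j ≤ w t i) → w' t i ≤ 0)
    (t : ℝ) (ht : 0 ≤ t) (i : ι) (hi : i ∈ s) : w t i ≤ 0 := by
  -- The slack `ε * (1 + t)` has slope `ε`, so a coordinate touching it, being a positive maximum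
  -- with nonpositive derivative, is pushed strictly below it. The times at which the bound holds
  -- are thus closed and open to the right.
  have key : ∀ ε : ℝ, 0 < ε → ∀ i ∈ s, w t i ≤ ε * (1 + t) := by
    intro ε hε
    let A : Set ℝ := {r | ∀ i ∈ s, w r i ≤ ε * (1 + r)}
    have hA : Set.Icc 0 t ⊆ A := by
      apply IsClosed.Icc_subset_of_forall_mem_nhdsWithin
      · have hAeq : A ∩ Set.Icc 0 t =
            Set.Icc 0 t ∩ ⋂ i ∈ s, {r ∈ Set.Icc 0 t | w r i ≤ ε * (1 + r)} := by
          ext r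
          simp only [A, Set.mem_inter_iff, Set.mem_ofPred_eq, Set.mem_iInter]
          constructor
          · rintro ⟨h1, h2⟩
            exact ⟨h2, fun i hi => ⟨h2, h1 i hi⟩⟩
          · rintro ⟨h1, h2⟩
            exact ⟨fun i hi => (h2 i hi).2, h1⟩
        rw [hAeq]
        refine isClosed_Icc.inter (isClosed_biInter fun i hi => ?_)
        refine isClosed_Icc.isClosed_le (fun r hr => ?_) (by fun_prop)
        exact (hd r hr.1 i hi).continuousAt.continuousWithinAt
      · intro i hi
        have := h0 i hi
        linarith
      · rintro r ⟨hrA, hr⟩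
        have hr0 : 0 ≤ r := hr.1
        have : ∀ i ∈ s, ∀ᶠ q in 𝓝[>] r, w q i ≤ ε * (1 + q) := by
          intro i hi
          have hder : HasDerivAt (fun q => w q i - ε * (1 + q)) (w' r i - ε) r := by
            have h1 := (((hasDerivAt_id r).const_add (1 : ℝ)).const_mul ε)
            rw [mul_one] at h1
            exact (hd r hr0 i hi).sub h1
          rcases lt_or_eq_of_le (hrA i hi) with hlt | heq
          · have hc := hder.continuousAt.eventually_lt continuousAt_const
              (show w r i - ε * (1 + r) < 0 by linarith)
            filter_upwards [nhdsWithin_le_nhds hc] with q hq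
            linarith
          · have hpos : 0 < w r i := by rw [heq]; positivity
            have hle := hmax r hr0 i hi hpos (fun j hj => heq ▸ hrA j hj)
            have hneg : w' r i - ε < 0 := by linarith
            have hs := (hasDerivAt_iff_tendsto_slope.1 hder).eventually (gt_mem_nhds hneg)
            have hs' : ∀ᶠ q in 𝓝[>] r,
                slope (fun q => w q i - ε * (1 + q)) r q < 0 :=
              hs.filter_mono (nhdsWithin_mono _ fun q hq => ne_of_gt hq)
            filter_upwards [hs', self_mem_nhdsWithin] with q hq hrq
            rw [slope_def_field, div_lt_iff₀ (sub_pos.2 hrq)] at hq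
            linarith
        exact (Finset.eventually_all s).2 this
    exact hA ⟨ht, le_rfl⟩
  by_contra! hpos
  have h1 := key (w t i / (2 * (1 + t))) (by positivity) i hi
  have h2 : w t i / (2 * (1 + t)) * (1 + t) = w t i / 2 := by field_simp
  linarith

/-- A solution of the discrete heat equation on `{1, …, n - 2}` stays below any bound of its initial
and boundary values. -/
theorem heat_le (n : ℕ) (h : ℝ → ℕ → ℝ) (M : ℝ)
    (hd : ∀ t, 0 ≤ t → ∀ x, 0 < x → x + 1 < n →
      HasDerivAt (fun r => h r x) (h t (x + 1) + h t (x - 1) - 2 * h t x) t)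
    (hl : ∀ t, 0 ≤ t → h t 0 ≤ M) (hr : ∀ t, 0 ≤ t → h t (n - 1) ≤ M)
    (h0 : ∀ x, 0 < x → x + 1 < n → h 0 x ≤ M)
    (t : ℝ) (ht : 0 ≤ t) (x : ℕ) (hx : 0 < x) (hxn : x + 1 < n) : h t x ≤ M := by
  have mem : ∀ x, x ∈ Finset.Ioo 0 (n - 1) ↔ 0 < x ∧ x + 1 < n := by
    intro x; rw [Finset.mem_Ioo]; omega
  have := nonpos_of_deriv_nonpos_at_max (Finset.Ioo 0 (n - 1)) (fun t x => h t x - M)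
    (fun t x => h t (x + 1) + h t (x - 1) - 2 * h t x)
    (fun t ht x hx => (hd t ht x ((mem x).1 hx).1 ((mem x).1 hx).2).sub_const M)
    (fun x hx => by
      have := h0 x ((mem x).1 hx).1 ((mem x).1 hx).2
      simpa using this)
    (fun t ht x hx hpos hm => by
      have hx' := (mem x).1 hx
      have h1 : h t (x + 1) ≤ h t x := by
        by_cases hc : x + 1 + 1 < n
        · have := hm (x + 1) ((mem _).2 ⟨by omega, hc⟩)
          linarith
        · have := hr t ht
          rw [show n - 1 = x + 1 by omega] at this
          linarith
      have h2 : h t (x - 1) ≤ h t x := by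
        by_cases hc : 0 < x - 1
        · have := hm (x - 1) ((mem _).2 ⟨hc, by omega⟩)
          linarith
        · have := hl t ht
          rw [show x - 1 = 0 by omega]
          linarith
      linarith)
    t ht x ((mem x).2 ⟨hx, hxn⟩)
  linarith

/-! ### The barrier and comparison with it -/

/-- The stationary solution, up to sign and normalisation, of the equation for the two-point
correlations with unit source on the diagonal. -/
noncomputable def barrier (n : ℕ) (x y : ℕ) : ℝ :=
  ((x : ℝ) + n - 1) * (2 * n - 1 - y) / (3 * n - 3)

theorem barrier_le {n x y : ℕ} (hn : 3 ≤ n) (hx : x < n) (hy : y < n) :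
    barrier n x y ≤ 2 * n := by
  have hn' : (3 : ℝ) ≤ n := by exact_mod_cast hn
  have hx' : (x : ℝ) + 1 ≤ n := by exact_mod_cast hx
  have hy' : (y : ℝ) + 1 ≤ n := by exact_mod_cast hy
  have hy0 : (0 : ℝ) ≤ y := y.cast_nonneg
  have hx0 : (0 : ℝ) ≤ x := x.cast_nonneg
  rw [barrier, div_le_iff₀ (by linarith)]
  have : ((x : ℝ) + n - 1) * (2 * n - 1 - y) ≤ (2 * n) * (2 * n) := by
    apply mul_le_mul <;> linarith
  nlinarith

theorem barrier_nonneg {n x y : ℕ} (hn : 3 ≤ n) (hy : y ≤ n) :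
    0 ≤ barrier n x y := by
  have hn' : (3 : ℝ) ≤ n := by exact_mod_cast hn
  have hy' : (y : ℝ) ≤ n := by exact_mod_cast hy
  have hx0 : (0 : ℝ) ≤ x := x.cast_nonneg
  exact div_nonneg (mul_nonneg (by linarith) (by linarith)) (by linarith)

/-- The shift `n - 1` in the first factor is chosen for this: the factor is `n - 1` at `0` and `n`
at `1`, which is the Robin ratio. The second factor mirrors it at the other end. -/
theorem barrier_zero_left {n : ℕ} (hn : 3 ≤ n) (y : ℕ) :
    barrier n 0 y = (1 - 1 / n) * barrier n 1 y := by
  have hn' : (3 : ℝ) ≤ n := by exact_mod_cast hn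
  have h1 : (n : ℝ) ≠ 0 := by linarith
  have h2 : (3 * (n : ℝ) - 3) ≠ 0 := by linarith
  simp only [barrier]
  push_cast
  field_simp
  ring

theorem barrier_self_right {n : ℕ} (hn : 3 ≤ n) (x : ℕ) :
    barrier n x n = (1 - 1 / n) * barrier n x (n - 1) := by
  have hn' : (3 : ℝ) ≤ n := by exact_mod_cast hn
  have h1 : (n : ℝ) ≠ 0 := by linarith
  have h2 : (3 * (n : ℝ) - 3) ≠ 0 := by linarith
  simp only [barrier]
  rw [Nat.cast_sub (by omega)]
  push_cast
  field_simp
  ring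

/-- A product of affine functions of separate variables is discretely harmonic. -/
theorem barrier_bulk {n x y : ℕ} (hx : 0 < x) (hy : 0 < y) :
    barrier n (x - 1) y + barrier n (x + 1) y + barrier n x (y + 1) + barrier n x (y - 1)
      - 4 * barrier n x y = 0 := by
  obtain ⟨x, rfl⟩ := Nat.exists_eq_succ_of_ne_zero hx.ne'
  obtain ⟨y, rfl⟩ := Nat.exists_eq_succ_of_ne_zero hy.ne'
  simp only [barrier, Nat.succ_eq_add_one, Nat.add_sub_cancel]
  push_cast
  ring

/-- The two increments add up to minus the sum of the factors at `(x, x + 1)`, and this sum is `3 *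
n - 3` for every `x`; hence the denominator. -/
theorem barrier_diag {n x : ℕ} (hn : 3 ≤ n) (hx : 0 < x) :
    barrier n (x - 1) (x + 1) + barrier n x (x + 2) - 2 * barrier n x (x + 1) = -1 := by
  have hn' : (3 : ℝ) ≤ n := by exact_mod_cast hn
  have h2 : (3 * (n : ℝ) - 3) ≠ 0 := by linarith
  obtain ⟨x, rfl⟩ := Nat.exists_eq_succ_of_ne_zero hx.ne'
  simp only [barrier, Nat.succ_eq_add_one, Nat.add_sub_cancel]
  push_cast
  rw [mul_div_assoc', ← add_div, ← sub_div, div_eq_iff h2]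
  ring

/-- Comparison with the barrier for the equation of the two-point correlations. -/
theorem correlation_le_barrier {n : ℕ} (hn : 3 ≤ n) (D : ℝ → ℕ → ℕ → ℝ) (g : ℝ → ℕ → ℝ)
    (M c : ℝ) (hM : 0 ≤ M) (hc : 0 ≤ c) (hg : ∀ t, 0 ≤ t → ∀ x, 0 < x → x + 1 < n → g t x ≤ c)
    (hbulk : ∀ t, 0 ≤ t → ∀ x y, 0 < x → x + 1 < y → y < n →
      HasDerivAt (fun r => D r x y)
        (D t (x - 1) y + D t (x + 1) y + D t x (y + 1) + D t x (y - 1) - 4 * D t x y) t)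
    (hdiag : ∀ t, 0 ≤ t → ∀ x, 0 < x → x + 1 < n →
      HasDerivAt (fun r => D r x (x + 1))
        (D t (x - 1) (x + 1) + D t x (x + 2) - 2 * D t x (x + 1) + g t x) t)
    (hl : ∀ t, 0 ≤ t → ∀ y, D t 0 y = (1 - 1 / n) * D t 1 y)
    (hr : ∀ t, 0 ≤ t → ∀ x, D t x n = (1 - 1 / n) * D t x (n - 1))
    (h0 : ∀ x y, 0 < x → x < y → y < n → D 0 x y ≤ M)
    (t : ℝ) (ht : 0 ≤ t) (x y : ℕ) (hx : 0 < x) (hxy : x < y) (hy : y < n) :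
    D t x y ≤ M + c * barrier n x y := by
  let V : Finset (ℕ × ℕ) := (Finset.range n ×ˢ Finset.range n).filter fun p => 0 < p.1 ∧ p.1 < p.2
  have mem : ∀ x y, (x, y) ∈ V ↔ 0 < x ∧ x < y ∧ y < n := by
    intro x y
    simp only [V, Finset.mem_filter, Finset.mem_product, Finset.mem_range]
    omega
  have hn0 : (0 : ℝ) < 1 / n := by
    have : (0 : ℝ) < n := by exact_mod_cast (by omega : 0 < n)
    positivity
  have main := nonpos_of_deriv_nonpos_at_max V
    (fun t p => D t p.1 p.2 - (M + c * barrier n p.1 p.2))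
    (fun t p => if p.2 = p.1 + 1 then
        D t (p.1 - 1) p.2 + D t p.1 (p.2 + 1) - 2 * D t p.1 p.2 + g t p.1
      else D t (p.1 - 1) p.2 + D t (p.1 + 1) p.2 + D t p.1 (p.2 + 1) + D t p.1 (p.2 - 1)
        - 4 * D t p.1 p.2) ?_ ?_ ?_ t ht (x, y) ((mem x y).2 ⟨hx, hxy, hy⟩)
  · simpa using main
  · rintro t ht ⟨x, y⟩ hp
    obtain ⟨hx, hxy, hy⟩ := (mem x y).1 hp
    by_cases h : y = x + 1
    · subst h
      simpa using (hdiag t ht x hx hy).sub_const (M + c * barrier n x (x + 1))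
    · simpa [h] using
        (hbulk t ht x y hx (by omega) hy).sub_const (M + c * barrier n x y)
  · rintro ⟨x, y⟩ hp
    obtain ⟨hx, hxy, hy⟩ := (mem x y).1 hp
    have h1 := h0 x y hx hxy hy
    have h2 := mul_nonneg hc (barrier_nonneg (x := x) hn hy.le)
    simp only
    linarith
  · rintro t ht ⟨x, y⟩ hp hpos hm
    obtain ⟨hx, hxy, hy⟩ := (mem x y).1 hp
    simp only at hpos hm ⊢
    have hm' : ∀ x' y', 0 < x' → x' < y' → y' < n →
        D t x' y' - (M + c * barrier n x' y') ≤ D t x y - (M + c * barrier n x y) :=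
      fun x' y' h1 h2 h3 => hm (x', y') ((mem x' y').2 ⟨h1, h2, h3⟩)
    -- At a ghost site the Robin relation makes the difference `(1 - 1 / n)` times its value at the
    -- adjacent site, minus `M / n`. This does not exceed the positive maximum because `M` is
    -- nonnegative.
    have hL : D t (x - 1) y - (M + c * barrier n (x - 1) y)
        ≤ D t x y - (M + c * barrier n x y) := by
      by_cases h : 0 < x - 1
      · exact hm' _ _ h (by omega) hy
      · obtain rfl : x = 1 := by omega
        rw [Nat.sub_self, hl t ht, barrier_zero_left hn]
        nlinarith [mul_pos hn0 hpos, mul_nonneg hn0.le hM]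
    have hR : D t x (y + 1) - (M + c * barrier n x (y + 1))
        ≤ D t x y - (M + c * barrier n x y) := by
      by_cases h : y + 1 < n
      · exact hm' _ _ hx (by omega) h
      · obtain rfl : n = y + 1 := by omega
        rw [hr t ht, barrier_self_right hn, Nat.add_sub_cancel]
        nlinarith [mul_pos hn0 hpos, mul_nonneg hn0.le hM]
    split_ifs with h
    · subst h
      have hb := barrier_diag hn hx
      have := hg t ht x hx hy
      have hb' : c * barrier n (x - 1) (x + 1) + c * barrier n x (x + 2)
        - 2 * (c * barrier n x (x + 1)) = -c := by linear_combination c * hb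
      linarith
    · have hb := barrier_bulk (n := n) hx (hx.trans hxy)
      have hb' : c * barrier n (x - 1) y + c * barrier n (x + 1) y + c * barrier n x (y + 1)
        + c * barrier n x (y - 1) - 4 * (c * barrier n x y) = 0 := by linear_combination c * hb
      -- Off the diagonal band the neighbours towards the diagonal still lie in the triangle, since
      -- `x + 1 < y`.
      have h1 := hm' (x + 1) y (by omega) (by omega) hy
      have h2 := hm' x (y - 1) hx (by omega) (by omega)
      linarith

/-! ### Action of the generator on one and two occupation variables -/

section Generator

variable {n : ℕ}

theorem occ_nonneg (x : Site n) (η : Config n) : 0 ≤ occ x η := by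
  rw [occ]; split_ifs <;> norm_num

theorem occ_le_one (x : Site n) (η : Config n) : occ x η ≤ 1 := by
  rw [occ]; split_ifs <;> norm_num

theorem occ_exchange_sub {x y : Site n} (hxy : x ≠ y) (z : Site n) (η : Config n) :
    occ z (exchange x y η) - occ z η =
      (if z = x then occ y η - occ z η else 0) + (if z = y then occ x η - occ z η else 0) := by
  unfold occ exchange
  by_cases h1 : z = x
  · have : z ≠ y := h1 ▸ hxy
    simp [h1, hxy]
  · by_cases h2 : z = y
    · have : y ≠ x := hxy.symm
      simp [h2, this]
    · simp [h1, h2]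

/-- This linearity in the occupation variable is what closes the moment equations at the boundary.
-/
theorem flipRate_mul_occ_flipAt_sub (r : ℝ) (x z : Site n) (η : Config n) :
    flipRate r x η * (occ z (flipAt x η) - occ z η) = if z = x then r - occ z η else 0 := by
  unfold flipRate occ flipAt
  by_cases h : z = x
  · subst h
    cases η z <;> simp
  · simp [h]

/-- The occupation variables, extended to `0` and `n` in such a way that the generator acts on them
as the discrete Laplacian. -/
noncomputable def extOcc (α β : ℝ) (n k : ℕ) (η : Config n) : ℝ :=
  if h : k ∈ Finset.Ioo 0 n then occ ⟨k, h⟩ η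
  else if k = 0 then
    (if h : 1 ∈ Finset.Ioo 0 n then (1 - 1 / n) * occ ⟨1, h⟩ η + α / n else 0)
  else
    (if h : n - 1 ∈ Finset.Ioo 0 n then (1 - 1 / n) * occ ⟨n - 1, h⟩ η + β / n else 0)

theorem extOcc_site (α β : ℝ) (x : Site n) : extOcc α β n x.1 = occ x := by
  funext η
  simp [extOcc, x.2]

theorem extOcc_zero (α β : ℝ) (hn : 2 ≤ n) :
    extOcc α β n 0 = (1 - 1 / (n : ℝ)) • extOcc α β n 1 + (α / n) • (1 : Config n → ℝ) := by
  funext η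
  have h : 1 ∈ Finset.Ioo 0 n := by rw [Finset.mem_Ioo]; omega
  have h' : 1 < n := by omega
  simp [extOcc, h']

theorem extOcc_self (α β : ℝ) (hn : 2 ≤ n) :
    extOcc α β n n = (1 - 1 / (n : ℝ)) • extOcc α β n (n - 1) + (β / n) • (1 : Config n → ℝ) := by
  funext η
  have h : 0 < n := by omega
  have h' : 1 < n := by omega
  simp [extOcc, h', h, h.ne']

theorem sum_site_right (f : Site n → ℝ) (k : ℕ) :
    (∑ y : Site n, if y.1 = k then f y else 0) =
      if h : k ∈ Finset.Ioo 0 n then f ⟨k, h⟩ else 0 := by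
  split_ifs with h
  · rw [Finset.sum_eq_single (⟨k, h⟩ : Site n)]
    · simp
    · intro y _ hy
      rw [if_neg]
      exact fun h' => hy (Subtype.ext h')
    · simp
  · refine Finset.sum_eq_zero fun y _ => if_neg ?_
    rintro rfl
    exact h y.2

theorem bulkGen_occ (z : Site n) (η : Config n) :
    bulkGen n (occ z) η =
      (∑ y : Site n, if y.1 = z.1 + 1 then occ y η - occ z η else 0) +
      ∑ y : Site n, if y.1 = z.1 - 1 then occ y η - occ z η else 0 := by
  have hne : ∀ x y : Site n, y.1 = x.1 + 1 → x ≠ y := by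
    rintro x y h rfl
    omega
  have : ∀ x y : Site n, (if y.1 = x.1 + 1 then occ z (exchange x y η) - occ z η else 0) =
      (if x = z then if y.1 = z.1 + 1 then occ y η - occ z η else 0 else 0) +
      (if y = z then if x.1 = z.1 - 1 then occ x η - occ z η else 0 else 0) := by
    intro x y
    by_cases h : y.1 = x.1 + 1
    · rw [if_pos h, occ_exchange_sub (hne x y h)]
      congr 1
      · by_cases hx : z = x
        · subst hx; simp [h]
        · simp [hx, Ne.symm hx]
      · by_cases hy : z = y
        · subst hy; simp [h]
        · simp [hy, Ne.symm hy]
    · rw [if_neg h]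
      by_cases hx : x = z
      · subst hx
        by_cases hy : y = x
        -- Truncated subtraction is harmless because sites are positive.
        · have : x.1 ≠ x.1 - 1 := by have := Finset.mem_Ioo.1 x.2; omega
          simp [hy, this]
        · simp [h, hy]
      · by_cases hy : y = z
        · subst hy
          have : x.1 ≠ y.1 - 1 := by have := Finset.mem_Ioo.1 y.2; omega
          simp [hx, this]
        · simp [hx, hy]
  simp only [bulkGen, this, Finset.sum_add_distrib]
  congr 1
  · rw [Finset.sum_comm]
    simp
  · simp

theorem boundaryGen_occ (α β : ℝ) (z : Site n) (η : Config n) :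
    boundaryGen α β n (occ z) η =
      (1 / (n : ℝ)) * ((if z.1 = 1 then α - occ z η else 0) +
        (if z.1 + 1 = n then β - occ z η else 0)) := by
  unfold boundaryGen
  congr 1
  rw [Finset.sum_eq_single z]
  · simp only [flipRate_mul_occ_flipAt_sub, if_true]
  · intro x _ hx
    simp [flipRate_mul_occ_flipAt_sub, Ne.symm hx]
  · simp

theorem generator_occ (α β : ℝ) (z : Site n) :
    generator α β n (occ z) =
      extOcc α β n (z.1 + 1) + extOcc α β n (z.1 - 1) - (2 : ℝ) • extOcc α β n z.1 := by
  funext η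
  have hz := Finset.mem_Ioo.1 z.2
  have hgen : generator α β n (occ z) η = bulkGen n (occ z) η + boundaryGen α β n (occ z) η := rfl
  rw [hgen, bulkGen_occ, boundaryGen_occ, sum_site_right, sum_site_right]
  simp only [Pi.add_apply, Pi.sub_apply, Pi.smul_apply, smul_eq_mul]
  -- The two ends are treated separately, so the case `n = 2`, where one site touches both
  -- reservoirs, is included.
  have hr : (if h : z.1 + 1 ∈ Finset.Ioo 0 n then occ (⟨z.1 + 1, h⟩ : Site n) η - occ z η else 0) +
      (1 / (n : ℝ)) * (if z.1 + 1 = n then β - occ z η else 0) =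
      extOcc α β n (z.1 + 1) η - occ z η := by
    by_cases h : z.1 + 1 = n
    · have h2 : extOcc α β n (z.1 + 1) η = (1 - 1 / (n : ℝ)) * occ z η + β / n := by
        have h3 := congrFun (extOcc_self α β (n := n) (by omega)) η
        rw [show n - 1 = z.1 by omega, extOcc_site] at h3
        rw [h]
        simpa using h3
      rw [h2, dif_neg (by simp [h]), if_pos h]
      ring
    · have h1 : z.1 + 1 ∈ Finset.Ioo 0 n := Finset.mem_Ioo.2 (by omega)
      rw [dif_pos h1, if_neg h, extOcc, dif_pos h1]
      ring
  have hl : (if h : z.1 - 1 ∈ Finset.Ioo 0 n then occ (⟨z.1 - 1, h⟩ : Site n) η - occ z η else 0) +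
      (1 / (n : ℝ)) * (if z.1 = 1 then α - occ z η else 0) =
      extOcc α β n (z.1 - 1) η - occ z η := by
    by_cases h : z.1 = 1
    · have h2 : extOcc α β n (z.1 - 1) η = (1 - 1 / (n : ℝ)) * occ z η + α / n := by
        have h3 := congrFun (extOcc_zero α β (n := n) (by omega)) η
        rw [← h, extOcc_site] at h3
        rw [show z.1 - 1 = 0 by omega]
        simpa using h3
      rw [h2, dif_neg (by simp [h]), if_pos h]
      ring
    · have h1 : z.1 - 1 ∈ Finset.Ioo 0 n := Finset.mem_Ioo.2 (by omega)
      rw [dif_pos h1, if_neg h, extOcc, dif_pos h1]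
      ring
  rw [extOcc_site]
  linear_combination hr + hl

/-- The defect in the Leibniz rule is the sum over moves of rate times the product of the two
increments. A flip changes one site only, so just the exchange across a bond joining `x` and `y`
contributes. -/
theorem generator_occ_mul_occ (α β : ℝ) {x y : Site n} (hxy : x < y) :
    generator α β n (occ x * occ y) =
      occ x * generator α β n (occ y) + occ y * generator α β n (occ x)
        - if y.1 = x.1 + 1 then (occ x - occ y) * (occ x - occ y) else 0 := by
  funext η
  have hlt : x.1 < y.1 := hxy
  have hne : x ≠ y := ne_of_lt hxy
  have hbulk : bulkGen n (occ x * occ y) η =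
      occ x η * bulkGen n (occ y) η + occ y η * bulkGen n (occ x) η
        - if y.1 = x.1 + 1 then (occ x η - occ y η) * (occ x η - occ y η) else 0 := by
    have hΓ : (if y.1 = x.1 + 1 then (occ x η - occ y η) * (occ x η - occ y η) else 0) =
        ∑ u : Site n, ∑ v : Site n, if u = x then if v = y then if y.1 = x.1 + 1 then
          (occ x η - occ y η) * (occ x η - occ y η) else 0 else 0 else 0 := by
      simp
    rw [hΓ]
    simp only [bulkGen, Finset.mul_sum, ← Finset.sum_add_distrib, ← Finset.sum_sub_distrib]
    refine Finset.sum_congr rfl fun u _ => Finset.sum_congr rfl fun v _ => ?_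
    by_cases huv : v.1 = u.1 + 1
    · have huv' : u ≠ v := by
        rintro rfl
        omega
      have hp : ((occ x (exchange u v η) - occ x η) * (occ y (exchange u v η) - occ y η)) =
          - if u = x then if v = y then if y.1 = x.1 + 1 then
          (occ x η - occ y η) * (occ x η - occ y η) else 0 else 0 else 0 := by
        rw [occ_exchange_sub huv', occ_exchange_sub huv']
        by_cases h1 : u = x
        · subst h1
          have h3 : y ≠ u := hne.symm
          by_cases h2 : v = y
          · subst h2
            simp [hne, h3, huv]
            ring
          · simp [h2, h3, Ne.symm h2]
        · by_cases h2 : v = x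
          · subst h2
            have h3 : y ≠ u := by
              rintro rfl
              omega
            simp [h1, h3, hne.symm]
          · simp [h1, Ne.symm h1, Ne.symm h2]
      simp only [if_pos huv, Pi.mul_apply]
      linear_combination hp
    · have : ¬ (u = x ∧ v = y ∧ y.1 = x.1 + 1) := by
        rintro ⟨rfl, rfl, h⟩
        exact huv h
      rw [if_neg huv, if_neg huv, if_neg huv]
      split_ifs <;> simp_all
  have hbd : boundaryGen α β n (occ x * occ y) η =
      occ x η * boundaryGen α β n (occ y) η + occ y η * boundaryGen α β n (occ x) η := by
    simp only [boundaryGen]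
    rw [mul_left_comm, mul_left_comm (occ y η), ← mul_add]
    congr 1
    simp only [Finset.mul_sum, ← Finset.sum_add_distrib]
    refine Finset.sum_congr rfl fun u _ => ?_
    have hp : ∀ r, flipRate r u η *
        ((occ x * occ y) (flipAt u η) - (occ x * occ y) η) =
        occ x η * (flipRate r u η * (occ y (flipAt u η) - occ y η)) +
        occ y η * (flipRate r u η * (occ x (flipAt u η) - occ x η)) := by
      intro r
      have h0 : (occ x (flipAt u η) - occ x η) * (occ y (flipAt u η) - occ y η) = 0 := by
        by_cases h : x = u
        · have : y ≠ u := h ▸ hne.symm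
          simp [occ, flipAt, this]
        · simp [occ, flipAt, h]
      simp only [Pi.mul_apply]
      linear_combination flipRate r u η * h0
    rw [hp, hp]
    split_ifs <;> ring
  have e : ∀ f, generator α β n f η = bulkGen n f η + boundaryGen α β n f η := fun _ => rfl
  simp only [Pi.add_apply, Pi.sub_apply, Pi.mul_apply, e, hbulk, hbd]
  split_ifs <;> simp <;> ring

end Generator

/-! ### Evolution equations and uniform bounds -/

section Evolution

variable {n : ℕ} {α β : ℝ} {E : ℝ → ((Config n → ℝ) →ₗ[ℝ] ℝ)}

/-- The covariance of two extended occupation variables under a linear functional. -/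
noncomputable def extCov (α β : ℝ) (n : ℕ) (E : (Config n → ℝ) →ₗ[ℝ] ℝ) (j k : ℕ) : ℝ :=
  E (extOcc α β n j * extOcc α β n k) - E (extOcc α β n j) * E (extOcc α β n k)

/-- The ghost variable is affine in the occupation of site `1`, and the additive constant drops out
of a covariance. -/
theorem extCov_zero_left (hn : 2 ≤ n) (F : (Config n → ℝ) →ₗ[ℝ] ℝ) (hF : F 1 = 1) (k : ℕ) :
    extCov α β n F 0 k = (1 - 1 / n) * extCov α β n F 1 k := by
  simp only [extCov, extOcc_zero α β hn, add_mul, smul_mul_assoc, one_mul, map_add, map_smul,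
    smul_eq_mul, hF]
  ring

theorem extCov_self_right (hn : 2 ≤ n) (F : (Config n → ℝ) →ₗ[ℝ] ℝ) (hF : F 1 = 1) (j : ℕ) :
    extCov α β n F j n = (1 - 1 / n) * extCov α β n F j (n - 1) := by
  simp only [extCov, extOcc_self α β hn, mul_add, mul_smul_comm, mul_one, map_add, map_smul,
    smul_eq_mul, hF]
  ring

theorem hasDerivAt_extOcc (hE : ∀ t f, HasDerivAt (fun r => E r f) (E t (generator α β n f)) t)
    (t : ℝ) {k : ℕ} (hk : 0 < k) (hkn : k < n) :
    HasDerivAt (fun r => E r (extOcc α β n k))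
      (E t (extOcc α β n (k + 1)) + E t (extOcc α β n (k - 1)) - 2 * E t (extOcc α β n k)) t := by
  have h := hE t (extOcc α β n k)
  let z : Site n := ⟨k, Finset.mem_Ioo.2 ⟨hk, hkn⟩⟩
  have hg := generator_occ α β z
  rw [← extOcc_site α β z] at hg
  change generator α β n (extOcc α β n k) = extOcc α β n (k + 1) + extOcc α β n (k - 1)
    - (2 : ℝ) • extOcc α β n k at hg
  rw [hg] at h
  simpa only [map_add, map_sub, map_smul, smul_eq_mul] using h

theorem hasDerivAt_extCov (hE : ∀ t f, HasDerivAt (fun r => E r f) (E t (generator α β n f)) t)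
    (t : ℝ) {j k : ℕ} (hj : 0 < j) (hjk : j < k) (hk : k < n) :
    HasDerivAt (fun r => extCov α β n (E r) j k)
      (extCov α β n (E t) (j - 1) k + extCov α β n (E t) (j + 1) k
        + extCov α β n (E t) j (k + 1) + extCov α β n (E t) j (k - 1)
        - 4 * extCov α β n (E t) j k
        - if k = j + 1 then E t ((extOcc α β n j - extOcc α β n k) *
            (extOcc α β n j - extOcc α β n k)) else 0) t := by
  let x : Site n := ⟨j, Finset.mem_Ioo.2 ⟨hj, hjk.trans hk⟩⟩
  let y : Site n := ⟨k, Finset.mem_Ioo.2 ⟨hj.trans hjk, hk⟩⟩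
  have hg := generator_occ_mul_occ α β (show x < y from hjk)
  rw [generator_occ, generator_occ, ← extOcc_site α β x, ← extOcc_site α β y] at hg
  change generator α β n (extOcc α β n j * extOcc α β n k) =
    extOcc α β n j * (extOcc α β n (k + 1) + extOcc α β n (k - 1) - (2 : ℝ) • extOcc α β n k)
    + extOcc α β n k * (extOcc α β n (j + 1) + extOcc α β n (j - 1) - (2 : ℝ) • extOcc α β n j)
    - (if k = j + 1 then (extOcc α β n j - extOcc α β n k) * (extOcc α β n j - extOcc α β n k)
        else 0) at hg
  have h := (hE t (extOcc α β n j * extOcc α β n k)).sub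
    ((hasDerivAt_extOcc hE t hj (hjk.trans hk)).mul (hasDerivAt_extOcc hE t (hj.trans hjk) hk))
  refine h.congr_deriv ?_
  rw [hg]
  have hif : E t (if k = j + 1 then (extOcc α β n j - extOcc α β n k) *
      (extOcc α β n j - extOcc α β n k) else 0) =
      if k = j + 1 then E t ((extOcc α β n j - extOcc α β n k) *
      (extOcc α β n j - extOcc α β n k)) else 0 := by
    split_ifs <;> simp
  rw [map_sub, hif]
  generalize (if k = j + 1 then E t _ else 0) = c
  simp only [map_sub, map_add, mul_add, mul_sub, mul_smul_comm, map_smul, smul_eq_mul, extCov]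
  rw [mul_comm (extOcc α β n k) (extOcc α β n (j + 1)),
    mul_comm (extOcc α β n k) (extOcc α β n (j - 1)), mul_comm (extOcc α β n k) (extOcc α β n j)]
  ring

/-- The general equation involves the variances at `j` and `j + 1`. Subtracting the mean square
difference cancels them, leaving twice the covariance and minus the squared difference of the means.
-/
theorem hasDerivAt_extCov_diag
    (hE : ∀ t f, HasDerivAt (fun r => E r f) (E t (generator α β n f)) t)
    (t : ℝ) {j : ℕ} (hj : 0 < j) (hjn : j + 1 < n) :
    HasDerivAt (fun r => extCov α β n (E r) j (j + 1))
      (extCov α β n (E t) (j - 1) (j + 1) + extCov α β n (E t) j (j + 2)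
        - 2 * extCov α β n (E t) j (j + 1)
        - (E t (extOcc α β n (j + 1)) - E t (extOcc α β n j)) ^ 2) t := by
  refine (hasDerivAt_extCov hE t hj j.lt_succ_self hjn).congr_deriv ?_
  rw [if_pos rfl, Nat.succ_eq_add_one, Nat.add_sub_cancel]
  simp only [extCov, sub_mul, mul_sub, map_sub]
  rw [mul_comm (extOcc α β n (j + 1)) (extOcc α β n j)]
  ring

theorem abs_gradient_le (hα : α ∈ Set.Icc (0 : ℝ) 1) (hβ : β ∈ Set.Icc (0 : ℝ) 1)
    (hE : ∀ t f, HasDerivAt (fun r => E r f) (E t (generator α β n f)) t)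
    (h1 : ∀ t, 0 ≤ t → E t 1 = 1) (hocc : ∀ t, 0 ≤ t → ∀ x : Site n, E t (occ x) ∈ Set.Icc 0 1)
    {M : ℝ} (hM : 1 ≤ M)
    (h0 : ∀ x, 0 < x → x + 1 < n →
      |E 0 (extOcc α β n (x + 1)) - E 0 (extOcc α β n x)| ≤ M / n)
    (t : ℝ) (ht : 0 ≤ t) (x : ℕ) (hx : 0 < x) (hxn : x + 1 < n) :
    |E t (extOcc α β n (x + 1)) - E t (extOcc α β n x)| ≤ M / n := by
  have hn : 2 ≤ n := by omega
  have hn0 : (0 : ℝ) < n := by exact_mod_cast (by omega : 0 < n)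
  have hocc' : ∀ t, 0 ≤ t → ∀ k, 0 < k → k < n → E t (extOcc α β n k) ∈ Set.Icc 0 1 := by
    intro t ht k hk hkn
    have := hocc t ht ⟨k, Finset.mem_Ioo.2 ⟨hk, hkn⟩⟩
    rwa [← extOcc_site α β] at this
  -- Used for the gradients across the ghost bonds, where one of `a`, `b` is a reservoir density;
  -- this is where `1 ≤ M` is needed.
  have hbd : ∀ a b : ℝ, a ∈ Set.Icc (0 : ℝ) 1 → b ∈ Set.Icc (0 : ℝ) 1 → |(a - b) / n| ≤ M / n := by
    intro a b ha hb
    rw [abs_div, abs_of_pos hn0]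
    gcongr
    refine le_trans (abs_le.2 ⟨?_, ?_⟩) hM <;> linarith [ha.1, ha.2, hb.1, hb.2]
  have hl : ∀ t, 0 ≤ t →
      |E t (extOcc α β n (0 + 1)) - E t (extOcc α β n 0)| ≤ M / n := by
    intro t ht
    have := hbd _ _ (hocc' t ht 1 one_pos (by omega)) hα
    rw [extOcc_zero α β hn, map_add, map_smul, map_smul, h1 t ht, smul_eq_mul, smul_eq_mul]
    convert this using 2
    ring
  have hr : ∀ t, 0 ≤ t →
      |E t (extOcc α β n (n - 1 + 1)) - E t (extOcc α β n (n - 1))| ≤ M / n := by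
    intro t ht
    have := hbd _ _ hβ (hocc' t ht (n - 1) (by omega) (by omega))
    rw [Nat.sub_add_cancel (by omega), extOcc_self α β hn, map_add, map_smul, map_smul, h1 t ht,
      smul_eq_mul, smul_eq_mul]
    convert this using 2
    ring
  have hd : ∀ t, 0 ≤ t → ∀ x, 0 < x → x + 1 < n →
      HasDerivAt (fun r => E r (extOcc α β n (x + 1)) - E r (extOcc α β n x))
        ((E t (extOcc α β n (x + 1 + 1)) - E t (extOcc α β n (x + 1)))
          + (E t (extOcc α β n (x - 1 + 1)) - E t (extOcc α β n (x - 1)))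
          - 2 * (E t (extOcc α β n (x + 1)) - E t (extOcc α β n x))) t := by
    intro t _ x hx hxn
    refine ((hasDerivAt_extOcc hE t x.succ_pos hxn).sub
      (hasDerivAt_extOcc hE t hx (by omega))).congr_deriv ?_
    rw [Nat.succ_eq_add_one, Nat.add_sub_cancel, Nat.sub_add_cancel hx]
    ring
  rw [abs_le']
  constructor
  · exact heat_le n (fun t x => E t (extOcc α β n (x + 1)) - E t (extOcc α β n x)) (M / n) hd
      (fun t ht => (abs_le'.1 (hl t ht)).1) (fun t ht => (abs_le'.1 (hr t ht)).1)
      (fun x hx hxn => (abs_le'.1 (h0 x hx hxn)).1) t ht x hx hxn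
  · exact heat_le n (fun t x => -(E t (extOcc α β n (x + 1)) - E t (extOcc α β n x))) (M / n)
      (fun t ht x hx hxn => (hd t ht x hx hxn).neg.congr_deriv (by ring))
      (fun t ht => (abs_le'.1 (hl t ht)).2) (fun t ht => (abs_le'.1 (hr t ht)).2)
      (fun x hx hxn => (abs_le'.1 (h0 x hx hxn)).2) t ht x hx hxn

theorem abs_extCov_le (hα : α ∈ Set.Icc (0 : ℝ) 1) (hβ : β ∈ Set.Icc (0 : ℝ) 1)
    (hE : ∀ t f, HasDerivAt (fun r => E r f) (E t (generator α β n f)) t)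
    (h1 : ∀ t, 0 ≤ t → E t 1 = 1) (hocc : ∀ t, 0 ≤ t → ∀ x : Site n, E t (occ x) ∈ Set.Icc 0 1)
    {M B : ℝ} (hM : 1 ≤ M) (hB : 0 ≤ B)
    (h0 : ∀ x, 0 < x → x + 1 < n →
      |E 0 (extOcc α β n (x + 1)) - E 0 (extOcc α β n x)| ≤ M / n)
    (hcov : ∀ x y, 0 < x → x < y → y < n → |extCov α β n (E 0) x y| ≤ B / n)
    (t : ℝ) (ht : 0 ≤ t) (x y : ℕ) (hx : 0 < x) (hxy : x < y) (hy : y < n) :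
    |extCov α β n (E t) x y| ≤ (B + 2 * M ^ 2) / n := by
  have hn : 3 ≤ n := by omega
  have hn0 : (0 : ℝ) < n := by exact_mod_cast (by omega : 0 < n)
  have hgrad : ∀ t, 0 ≤ t → ∀ x, 0 < x → x + 1 < n →
      (E t (extOcc α β n (x + 1)) - E t (extOcc α β n x)) ^ 2 ≤ (M / n) ^ 2 := by
    intro t ht x hx hxn
    exact sq_le_sq' (abs_le.1 (abs_gradient_le hα hβ hE h1 hocc hM h0 t ht x hx hxn)).1
      (abs_le.1 (abs_gradient_le hα hβ hE h1 hocc hM h0 t ht x hx hxn)).2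
  have hbulk : ∀ t, 0 ≤ t → ∀ x y, 0 < x → x + 1 < y → y < n →
      HasDerivAt (fun r => extCov α β n (E r) x y)
        (extCov α β n (E t) (x - 1) y + extCov α β n (E t) (x + 1) y
        + extCov α β n (E t) x (y + 1) + extCov α β n (E t) x (y - 1)
        - 4 * extCov α β n (E t) x y) t := by
    intro t _ x y hx hxy hy
    have := hasDerivAt_extCov hE t hx (by omega : x < y) hy
    rwa [if_neg (by omega), sub_zero] at this
  -- A source of size `(M / n) ^ 2` against a barrier of size `2 * n` gives `2 * M ^ 2 / n`.
  have hW : B / n + (M / n) ^ 2 * barrier n x y ≤ (B + 2 * M ^ 2) / n := by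
    calc B / n + (M / n) ^ 2 * barrier n x y
        ≤ B / n + (M / n) ^ 2 * (2 * n) := by
          gcongr
          exact barrier_le hn (hxy.trans hy) hy
      _ = (B + 2 * M ^ 2) / n := by field_simp
  refine le_trans ?_ hW
  have hB' : 0 ≤ B / n := by positivity
  rw [abs_le']
  -- The source is nonpositive for the covariance and at most `(M / n) ^ 2` for its negative, so one
  -- barrier serves both signs.
  constructor
  · exact correlation_le_barrier hn (fun t => extCov α β n (E t))
      (fun t x => -(E t (extOcc α β n (x + 1)) - E t (extOcc α β n x)) ^ 2) (B / n) ((M / n) ^ 2)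
      hB' (sq_nonneg _) (fun t _ x _ _ => (neg_nonpos.2 (sq_nonneg _)).trans (sq_nonneg _)) hbulk
      (fun t _ x hx hxn => (hasDerivAt_extCov_diag hE t hx hxn).congr_deriv (by ring))
      (fun t ht y => extCov_zero_left (by omega) _ (h1 t ht) y)
      (fun t ht x => extCov_self_right (by omega) _ (h1 t ht) x)
      (fun x y hx hxy hy => (abs_le'.1 (hcov x y hx hxy hy)).1) t ht x y hx hxy hy
  · exact correlation_le_barrier hn (fun t x y => -extCov α β n (E t) x y)
      (fun t x => (E t (extOcc α β n (x + 1)) - E t (extOcc α β n x)) ^ 2) (B / n) ((M / n) ^ 2)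
      hB' (sq_nonneg _) hgrad
      (fun t ht x y hx hxy hy => (hbulk t ht x y hx hxy hy).neg.congr_deriv (by ring))
      (fun t _ x hx hxn => (hasDerivAt_extCov_diag hE t hx hxn).neg.congr_deriv (by ring))
      (fun t ht y => by rw [extCov_zero_left (by omega) _ (h1 t ht) y]; ring)
      (fun t ht x => by rw [extCov_self_right (by omega) _ (h1 t ht) x]; ring)
      (fun x y hx hxy hy => (abs_le'.1 (hcov x y hx hxy hy)).2) t ht x y hx hxy hy

end Evolution

/-! ### From the process to the semigroup -/

section Law

variable {S : Type*} [Fintype S] [MeasurableSpace S] [MeasurableSingletonClass S]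

/-- The expectation at time `t` of an observable of the Markov process with generator `L` started
from `μ`, as a linear functional. -/
noncomputable def expectAt (L : (S → ℝ) →ₗ[ℝ] (S → ℝ)) (μ : Measure S) [IsFiniteMeasure μ]
    (t : ℝ) : (S → ℝ) →ₗ[ℝ] ℝ where
  toFun f := ∫ x, semigroup L t f x ∂μ
  map_add' f g := by
    rw [map_add]
    exact integral_add .of_finite .of_finite
  map_smul' c f := by
    rw [map_smul]
    exact integral_const_mul c _

theorem hasDerivAt_expectAt (L : (S → ℝ) →ₗ[ℝ] (S → ℝ)) (μ : Measure S) [IsFiniteMeasure μ]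
    (t : ℝ) (f : S → ℝ) :
    HasDerivAt (fun r => expectAt L μ r f) (expectAt L μ t (L f)) t := by
  let I : (S → ℝ) →L[ℝ] ℝ := LinearMap.toContinuousLinearMap
    { toFun := fun g => ∫ x, g x ∂μ
      map_add' := fun f g => integral_add .of_finite .of_finite
      map_smul' := fun c f => integral_const_mul c _ }
  have h := hasDerivAt_exp_smul_const (𝕂 := ℝ) (LinearMap.toContinuousLinearMap L) t
  exact I.hasFDerivAt.comp_hasDerivAt t (h.clm_apply (hasDerivAt_const t f)) |>.congr_deriv
    (by simp [I, expectAt, semigroup])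

theorem expectAt_zero (L : (S → ℝ) →ₗ[ℝ] (S → ℝ)) (μ : Measure S) [IsFiniteMeasure μ]
    (f : S → ℝ) : expectAt L μ 0 f = ∫ x, f x ∂μ := by
  simp [expectAt, semigroup]

/-- Take expectations in the Markov property at time `0` and use the initial law. -/
theorem IsMarkovProcess.integral_eq_expectAt {Ω : Type*} [TopologicalSpace S] [MeasurableSpace Ω]
    {L : (S → ℝ) →ₗ[ℝ] (S → ℝ)} {μ : Measure S} [IsFiniteMeasure μ] {P : Measure Ω}
    [IsProbabilityMeasure P] {X : ℝ≥0 → Ω → S} (hX : IsMarkovProcess L μ P X) (t : ℝ≥0)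
    (f : S → ℝ) : ∫ ω, f (X t ω) ∂P = expectAt L μ t f := by
  have hm : past X 0 ≤ (inferInstance : MeasurableSpace Ω) :=
    iSup_le fun r => (hX.measurable r).comap_le
  have h := hX.markov 0 t f
  rw [zero_add] at h
  rw [← integral_condExp hm, integral_congr_ae h]
  change _ = ∫ x, semigroup L t f x ∂μ
  rw [← hX.initial, integral_map (hX.measurable 0).aemeasurable
    (measurable_of_finite _).aestronglyMeasurable]

end Law

end SlowSSEP

/-! ### The uniform correlation bound -/

open SlowSSEP
theorem proposition7p2
    (α β : ℝ) (hα : α ∈ Set.Icc (0 : ℝ) 1) (hβ : β ∈ Set.Icc (0 : ℝ) 1)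
    -- the initial profile
    (ρ₀ : ℝ → ℝ) (hρ₀ : ∀ u ∈ Set.Icc (0 : ℝ) 1, ρ₀ u ∈ Set.Icc (0 : ℝ) 1)
    (K : ℝ≥0) (hK : LipschitzOnWith K ρ₀ (Set.Icc 0 1))
    -- the initial measures
    (μ : ∀ n : ℕ, Measure (Config n)) [∀ n, IsProbabilityMeasure (μ n)]
    (C₁ : ℝ) (hC₁ : ∀ (n : ℕ) (x : Site n), |mean (μ n) x - ρ₀ ((x.1 : ℝ) / n)| ≤ C₁ / n)
    (C₂ : ℝ) (hC₂ : ∀ (n : ℕ) (x y : Site n), x < y → |corr (μ n) x y| ≤ C₂ / n)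
    -- the exclusion processes with slow boundaries
    (Ω : ℕ → Type*) [∀ n, MeasurableSpace (Ω n)] (P : ∀ n, Measure (Ω n))
    [∀ n, IsProbabilityMeasure (P n)] (η : ∀ n, ℝ≥0 → Ω n → Config n)
    (hη : ∀ n, IsMarkovProcess (generator α β n) (μ n) (P n) (η n)) :
    ∃ C : ℝ, 0 < C ∧ ∀ n : ℕ, 1 ≤ n → ∀ (t : ℝ≥0) (x y : Site n), x < y →
      |twoPoint (P n) (η n) t x y| ≤ C / n := by
  -- Initial gradient constant: two errors `C₁ / n`, the Lipschitz increment `K / n` of the profile,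
  -- and an extra `1` to dominate the reservoir gradients.
  have hM : 1 ≤ 2 * |C₁| + K + 1 := by
    have := abs_nonneg C₁
    have := K.coe_nonneg
    linarith
  refine ⟨|C₂| + 2 * (2 * |C₁| + K + 1) ^ 2, by positivity, fun n hn t x y hxy => ?_⟩
  have hn0 : (0 : ℝ) < n := by exact_mod_cast hn
  let E : ℝ → ((Config n → ℝ) →ₗ[ℝ] ℝ) := expectAt (generator α β n) (μ n)
  have hEP : ∀ (s : ℝ≥0) f, E s f = ∫ ω, f (η n s ω) ∂(P n) := fun s f =>
    ((hη n).integral_eq_expectAt s f).symm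
  have h1 : ∀ s, 0 ≤ s → E s 1 = 1 := by
    intro s hs
    lift s to ℝ≥0 using hs
    rw [hEP]
    simp
  have hocc : ∀ s, 0 ≤ s → ∀ x : Site n, E s (occ x) ∈ Set.Icc 0 1 := by
    intro s hs x
    lift s to ℝ≥0 using hs
    rw [hEP]
    have hint : Integrable (fun ω => occ x (η n s ω)) (P n) :=
      (Integrable.of_bound (measurable_of_finite (occ x)).aestronglyMeasurable 1
        (.of_forall fun ξ => by
          rw [Real.norm_of_nonneg (occ_nonneg x ξ)]
          exact occ_le_one x ξ) : Integrable (occ x) ((P n).map (η n s))).comp_measurable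
        ((hη n).measurable s)
    refine ⟨integral_nonneg fun ω => occ_nonneg x _, ?_⟩
    calc ∫ ω, occ x (η n s ω) ∂(P n) ≤ ∫ _, (1 : ℝ) ∂(P n) :=
          integral_mono hint (integrable_const _) fun ω => occ_le_one x _
      _ = 1 := by simp
  have hmean : ∀ x : Site n, E 0 (extOcc α β n x.1) = mean (μ n) x := fun x => by
    rw [extOcc_site]
    exact expectAt_zero _ _ _
  have hcorr : ∀ x y : Site n, extCov α β n (E 0) x.1 y.1 = corr (μ n) x y := fun x y => by
    rw [extCov, hmean, hmean, extOcc_site, extOcc_site, corr]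
    congr 1
    exact expectAt_zero _ _ _
  have hcov : ∀ j k, 0 < j → j < k → k < n → |extCov α β n (E 0) j k| ≤ |C₂| / n := by
    intro j k hj hjk hk
    have h := hC₂ n ⟨j, Finset.mem_Ioo.2 ⟨hj, hjk.trans hk⟩⟩
      ⟨k, Finset.mem_Ioo.2 ⟨hj.trans hjk, hk⟩⟩ hjk
    rw [← hcorr] at h
    refine h.trans ?_
    gcongr
    exact le_abs_self _
  have h0 : ∀ j, 0 < j → j + 1 < n →
      |E 0 (extOcc α β n (j + 1)) - E 0 (extOcc α β n j)| ≤ (2 * |C₁| + K + 1) / n := by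
    intro j hj hjn
    have ha := hC₁ n ⟨j, Finset.mem_Ioo.2 ⟨hj, by omega⟩⟩
    have hb := hC₁ n ⟨j + 1, Finset.mem_Ioo.2 ⟨by omega, hjn⟩⟩
    rw [← hmean] at ha hb
    simp only at ha hb
    have hmem : ∀ k : ℕ, k ≤ n → (k : ℝ) / n ∈ Set.Icc (0 : ℝ) 1 := fun k hk =>
      ⟨by positivity, (div_le_one hn0).2 (by exact_mod_cast hk)⟩
    have hlip := hK.dist_le_mul _ (hmem (j + 1) hjn.le) _ (hmem j (by omega))
    have hdist : dist (((j + 1 : ℕ) : ℝ) / n) ((j : ℝ) / n) = 1 / n := by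
      rw [Real.dist_eq, ← sub_div]
      push_cast
      rw [add_sub_cancel_left, abs_of_pos (by positivity)]
    rw [hdist, Real.dist_eq] at hlip
    have hc : C₁ / n ≤ |C₁| / n := by
      gcongr
      exact le_abs_self _
    have hsum : (2 * |C₁| + K + 1) / n = |C₁| / n + |C₁| / n + K * (1 / n) + 1 / n := by ring
    have hpos : 0 < 1 / (n : ℝ) := by positivity
    rw [hsum, abs_le]
    rw [abs_le] at ha hb hlip
    constructor <;> linarith [ha.1, ha.2, hb.1, hb.2, hlip.1, hlip.2]
  have hx := Finset.mem_Ioo.1 x.2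
  have hy := Finset.mem_Ioo.1 y.2
  -- The estimate holds at every microscopic time, in particular at `t * n ^ 2`.
  have main := abs_extCov_le (E := E) hα hβ (hasDerivAt_expectAt _ _) h1 hocc hM (abs_nonneg C₂)
    h0 hcov ((t * (n : ℝ≥0) ^ 2 : ℝ≥0) : ℝ) (NNReal.coe_nonneg _) x.1 y.1 hx.1 hxy hy.2
  rw [extCov, extOcc_site, extOcc_site, hEP, hEP, hEP] at main
  exact main
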